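/- Let $d\ge 2$, $\varepsilon>0$ and $\gamma\in(-3,0]$. Put $G(v)=C e^{-(1+|v|^2)^{1/2}}$ on $\mathbb{R}^d$, with $C>0$ chosen so that $\int_{\mathbb{R}^d}G(v)\,dv=1$, and $G^\varepsilon(v)=\varepsilon^{-d}G(v/\varepsilon)$. Let $\Pi[z]$ be the orthogonal projection onto $\{z\}^\perp$. For a probability measure $g$ on $\mathbb{R}^d$ define \[ K_g(v,w)=-|v-w|^{2+\gamma}\,\Pi[v-w]\Big(\nabla G^\varepsilon*\log[g*G^\varepsilon](v)-\nabla G^\varepsilon*\log[g*G^\varepsilon](w)\Big) \] (with $K_g(v,v)=0$) and $U^\varepsilon[g](v)=\int_{\mathbb{R}^d}K_g(v,w)\,dg(w)$. For $N\in\mathbb{N}$, initial points $v_0^1,\dots,v_0^N\in\mathbb{R}^d$ and weights $m_1,\dots,m_N\ge 0$ with $\sum_{i=1}^N m_i=1$, consider the $N$-particle system \[ \frac{d}{dt}v^i(t)=U^\varepsilon[\mu^N(t)](v^i(t)),\qquad \mu^N(t)=\sum_{i=1}^N m_i\,\delta_{v^i(t)},\qquad v^i(0)=v_0^i,\qquad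 i=1,\dots,N. \tag{1} \] Then: (i) there is a time horizon $T>0$, depending only on $\varepsilon$, $\gamma$ and the initial points $\{v_0^i\}_{i=1}^N$ (in particular not on the weights), such that (1) has a solution with $v^i\in C^1([0,T];\mathbb{R}^d)$ for all $i=1,\dots,N$; (ii) if $\gamma\in[-2,0]$, then for every $T>0$ the system (1) has exactly one solution with $v^i\in C^1([0,T];\mathbb{R}^d)$ for all $i=1,\dots,N$. -/

import Mathlib

open MeasureTheory

noncomputable section

namespace RegLandau

/-- The velocity space `ℝ^d` with its Euclidean norm and Lebesgue measure. -/
abbrev Vel (d : ℕ) : Type := EuclideanSpace ℝ (Fin d)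

/-- The bracket `⟨v⟩ = (1 + |v|^2)^{1/2}`. -/
def bracket {d : ℕ} (v : Vel d) : ℝ := Real.sqrt (1 + ‖v‖ ^ 2)

/-- The profile `G(v) = C exp(-⟨v⟩)`, with `C` the constant for which `∫ G = 1`. -/
def G {d : ℕ} (v : Vel d) : ℝ :=
  (∫ w : Vel d, Real.exp (-bracket w))⁻¹ * Real.exp (-bracket v)

/-- The mollifier `G^ε(v) = ε^{-d} G(v / ε)`. -/
def Geps {d : ℕ} (ε : ℝ) (v : Vel d) : ℝ := (ε ^ d)⁻¹ * G (ε⁻¹ • v)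

/-- The mollified measure `g * G^ε`, a function on `ℝ^d`. -/
def mollify {d : ℕ} (ε : ℝ) (g : Measure (Vel d)) (v : Vel d) : ℝ :=
  ∫ w, Geps ε (v - w) ∂g

/-- The vector field `∇G^ε * log (g * G^ε)`. -/
def entropyGrad {d : ℕ} (ε : ℝ) (g : Measure (Vel d)) (v : Vel d) : Vel d :=
  ∫ w : Vel d, Real.log (mollify ε g w) • gradient (Geps ε) (v - w)

/-- The orthogonal projection `Π[z]` onto `{z}^⊥`. -/
def proj {d : ℕ} (z : Vel d) : Vel d →L[ℝ] Vel d :=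
  (Submodule.span ℝ {z})ᗮ.starProjection

/-- The interaction kernel
`K_g(v,w) = -|v-w|^{2+γ} Π[v-w] (∇G^ε * log (g*G^ε) (v) - ∇G^ε * log (g*G^ε) (w))`.
It vanishes at `v = w`, since the last factor does. -/
def kernelK {d : ℕ} (ε γ : ℝ) (g : Measure (Vel d)) (v w : Vel d) : Vel d :=
  -((‖v - w‖ ^ (2 + γ)) • proj (v - w) (entropyGrad ε g v - entropyGrad ε g w))

/-- The velocity `U^ε[g,f](v) = ∫ K_g(v,w) df(w)`. -/
def velocity₂ {d : ℕ} (ε γ : ℝ) (g f : Measure (Vel d)) (v : Vel d) : Vel d :=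
  ∫ w, kernelK ε γ g v w ∂f

/-- The velocity `U^ε[f] = U^ε[f,f]`. -/
def velocity {d : ℕ} (ε γ : ℝ) (f : Measure (Vel d)) (v : Vel d) : Vel d :=
  velocity₂ ε γ f f v

/-- The empirical measure `∑ i, m_i δ_{x_i}`. -/
def empirical {d N : ℕ} (m : Fin N → ℝ) (x : Fin N → Vel d) : Measure (Vel d) :=
  ∑ i, ENNReal.ofReal (m i) • Measure.dirac (x i)

/-- Weights of `N` particles: nonnegative with total mass one. -/
structure IsWeight {N : ℕ} (m : Fin N → ℝ) : Prop where
  nonneg : ∀ i, 0 ≤ m i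
  sum_eq_one : ∑ i, m i = 1

/-- `v = (v^1, …, v^N)` is a `C¹` solution on `[0,T]` of the `N`-particle system
`d/dt v^i = U^ε[μ^N(t)](v^i)`, `μ^N(t) = ∑ i, m_i δ_{v^i(t)}`, `v^i(0) = v₀^i`.
At the endpoints of `[0,T]` the derivatives are one-sided. -/
structure IsParticleSolution {d N : ℕ} (ε γ : ℝ) (m : Fin N → ℝ) (v₀ : Fin N → Vel d)
    (T : ℝ) (v : Fin N → ℝ → Vel d) : Prop where
  contDiffOn : ∀ i, ContDiffOn ℝ 1 (v i) (Set.Icc 0 T)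
  ode : ∀ i, ∀ t ∈ Set.Icc (0 : ℝ) T,
    HasDerivWithinAt (v i) (velocity ε γ (empirical m fun j => v j t) (v i t))
      (Set.Icc 0 T) t
  init : ∀ i, v i 0 = v₀ i

end RegLandau

end

namespace RegLandau

variable {d N : ℕ}

/-! The bracket is 1-Lipschitz, so `log G^ε` is `ε⁻¹`-Lipschitz, and averaging with weights keeps
this: `log (μ * G^ε)` is Lipschitz in the evaluation point and the particle positions together,
uniformly in the weights. As `∇G^ε` has a finite first moment and mean zero, `entropyGrad` is
Lipschitz and bounded with constants free of `m` (`norm_entropyGrad_sub_le`, `norm_entropyGrad_le`).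
The difference of entropy gradients in the kernel is thus `O(|v-w|)`, which pays for the singularity
of `|z|^{2+γ} Π[z]` at `z = 0`: the field is Lipschitz wherever `|x_i - x_j|^{2+γ}` is bounded over
distinct pairs (`norm_field_sub_le`).

(i) For `γ < -2` this bound requires distinct particles to stay apart. Particles starting at one
point are moved as one cluster; distinct clusters stay separated for a time that does not involve
the weights.

(ii) For `γ ≥ -2` bounded configurations suffice. Energy conservation bounds the particles of
positive weight and Grönwall the massless ones. Solving a truncated equation and observing that the
truncation is never active gives existence; uniqueness follows from the Lipschitz bound. -/

/-! ### The mollifier: decay, log-Lipschitz bound, gradient. -/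

theorem one_le_bracket (v : Vel d) : 1 ≤ bracket v :=
  Real.one_le_sqrt.2 (by nlinarith [sq_nonneg ‖v‖])

theorem norm_le_bracket (v : Vel d) : ‖v‖ ≤ bracket v :=
  Real.le_sqrt_of_sq_le (by linarith)

theorem bracket_le_bracket_add (v w : Vel d) : bracket v ≤ bracket w + ‖v - w‖ := by
  have h0 := one_le_bracket w
  have h1 := norm_le_bracket w
  have h2 : bracket w ^ 2 = 1 + ‖w‖ ^ 2 := Real.sq_sqrt (by positivity)
  have h3 : ‖v‖ ≤ ‖w‖ + ‖v - w‖ := by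
    simpa using norm_add_le w (v - w)
  refine Real.sqrt_le_iff.2 ⟨by positivity, ?_⟩
  have h4 : ‖v‖ ^ 2 ≤ (‖w‖ + ‖v - w‖) ^ 2 := by gcongr
  nlinarith [mul_le_mul_of_nonneg_right h1 (norm_nonneg (v - w))]

theorem continuous_bracket : Continuous (bracket : Vel d → ℝ) := by
  unfold bracket; fun_prop

theorem integrable_norm_add_one_mul_exp_neg_bracket :
    Integrable fun v : Vel d => (1 + ‖v‖) * Real.exp (-bracket v) := by
  have hd : (Module.finrank ℝ (Vel d) : ℝ) < (d + 1 : ℕ) := by simp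
  have h := (integrable_one_add_norm (μ := (volume : Measure (Vel d))) hd).const_mul
    ((d + 2).factorial * Real.exp 1)
  refine h.mono' (by have := continuous_bracket (d := d); fun_prop) (ae_of_all _ fun v => ?_)
  have hs : 0 < 1 + ‖v‖ := by positivity
  rw [Real.norm_of_nonneg (by positivity), Real.rpow_neg hs.le, Real.rpow_natCast]
  -- The power `d + 2` leaves decay of order `d + 1` after the factor `1 + ‖v‖`, enough for
  -- integrability in dimension `d`.
  have h1 := Real.pow_div_factorial_le_exp (1 + ‖v‖) hs.le (d + 2)
  have h2 : Real.exp (-bracket v) ≤ Real.exp 1 * (Real.exp (1 + ‖v‖))⁻¹ := by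
    rw [← Real.exp_neg, ← Real.exp_add]
    exact Real.exp_le_exp.2 (by linarith [norm_le_bracket v])
  have h3 : (Real.exp (1 + ‖v‖))⁻¹ ≤ ((1 + ‖v‖) ^ (d + 2) / (d + 2).factorial)⁻¹ := by
    gcongr
  calc (1 + ‖v‖) * Real.exp (-bracket v)
      ≤ (1 + ‖v‖) * (Real.exp 1 * ((1 + ‖v‖) ^ (d + 2) / (d + 2).factorial)⁻¹) := by
        gcongr; exact h2.trans (by gcongr)
    _ = _ := by field_simp; ring

theorem integrable_exp_neg_bracket : Integrable fun v : Vel d => Real.exp (-bracket v) := by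
  refine integrable_norm_add_one_mul_exp_neg_bracket.mono'
    (by have := continuous_bracket (d := d); fun_prop) (ae_of_all _ fun v => ?_)
  rw [Real.norm_of_nonneg (by positivity)]
  nlinarith [Real.exp_pos (-bracket v), norm_nonneg v]

theorem G_pos (v : Vel d) : 0 < G v :=
  mul_pos (inv_pos.2 (integral_exp_pos integrable_exp_neg_bracket)) (Real.exp_pos _)

theorem Geps_pos {ε : ℝ} (hε : 0 < ε) (v : Vel d) : 0 < Geps ε v :=
  mul_pos (by positivity) (G_pos _)

/-- Follows from the 1-Lipschitz bracket. This is where the exponential tail of `G` matters: a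
Gaussian has no globally Lipschitz logarithm. -/
theorem Geps_le {ε : ℝ} (hε : 0 < ε) (v w : Vel d) :
    Geps ε v ≤ Real.exp (ε⁻¹ * ‖v - w‖) * Geps ε w := by
  have h0 : 0 < ∫ w : Vel d, Real.exp (-bracket w) :=
    integral_exp_pos integrable_exp_neg_bracket
  have h : Real.exp (-bracket (ε⁻¹ • v)) ≤
      Real.exp (ε⁻¹ * ‖v - w‖) * Real.exp (-bracket (ε⁻¹ • w)) := by
    rw [← Real.exp_add]
    refine Real.exp_le_exp.2 ?_
    have := bracket_le_bracket_add (ε⁻¹ • w) (ε⁻¹ • v)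
    rw [← smul_sub, norm_smul, Real.norm_of_nonneg (by positivity), norm_sub_rev] at this
    linarith
  unfold Geps G
  calc _ ≤ (ε ^ d)⁻¹ * ((∫ w : Vel d, Real.exp (-bracket w))⁻¹ *
      (Real.exp (ε⁻¹ * ‖v - w‖) * Real.exp (-bracket (ε⁻¹ • w)))) := by gcongr
    _ = _ := by ring

theorem hasGradientAt_Geps (ε : ℝ) (v : Vel d) :
    HasGradientAt (Geps ε)
      (-(Geps ε v * ε⁻¹ * (bracket (ε⁻¹ • v))⁻¹) • (ε⁻¹ • v)) v := by
  rw [hasGradientAt_iff_hasFDerivAt]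
  have h1 : HasFDerivAt (fun v : Vel d => ε⁻¹ • v) (ε⁻¹ • ContinuousLinearMap.id ℝ (Vel d)) v :=
    (hasFDerivAt_id v).const_smul ε⁻¹
  have h2 := ((h1.norm_sq.const_add 1).sqrt (by positivity)).neg.exp.const_mul
    ((ε ^ d)⁻¹ * (∫ w : Vel d, Real.exp (-bracket w))⁻¹)
  have h3 : (fun v : Vel d => (ε ^ d)⁻¹ * (∫ w : Vel d, Real.exp (-bracket w))⁻¹ *
      Real.exp (-Real.sqrt (1 + ‖ε⁻¹ • v‖ ^ 2))) = Geps ε := by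
    ext v; simp only [Geps, G, bracket]; ring
  refine (h3 ▸ h2 : HasFDerivAt (Geps ε) _ v).congr_fderiv ?_
  ext w
  simp [Geps, G, bracket]
  ring

theorem gradient_Geps (ε : ℝ) (v : Vel d) :
    gradient (Geps ε) v = -(Geps ε v * ε⁻¹ * (bracket (ε⁻¹ • v))⁻¹) • (ε⁻¹ • v) :=
  (hasGradientAt_Geps ε v).gradient

theorem Geps_neg (ε : ℝ) (v : Vel d) : Geps ε (-v) = Geps ε v := by
  simp [Geps, G, bracket]

theorem gradient_Geps_neg (ε : ℝ) (v : Vel d) :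
    gradient (Geps ε) (-v) = -gradient (Geps ε) v := by
  simp [gradient_Geps, Geps_neg, bracket]

theorem norm_gradient_Geps_le {ε : ℝ} (hε : 0 < ε) (v : Vel d) :
    ‖gradient (Geps ε) v‖ ≤ ε⁻¹ * Geps ε v := by
  have hb : 0 < bracket (ε⁻¹ • v) := one_pos.trans_le (one_le_bracket _)
  have hG := Geps_pos hε v
  rw [gradient_Geps, norm_smul, Real.norm_eq_abs, abs_neg, abs_of_pos (by positivity)]
  calc _ ≤ (Geps ε v * ε⁻¹ * (bracket (ε⁻¹ • v))⁻¹) * bracket (ε⁻¹ • v) := by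
        gcongr; exact norm_le_bracket _
    _ = _ := by rw [mul_assoc, inv_mul_cancel₀ hb.ne']; ring

theorem continuous_Geps (ε : ℝ) : Continuous (Geps ε : Vel d → ℝ) := by
  have := continuous_bracket (d := d)
  unfold Geps G; fun_prop

theorem continuous_gradient_Geps (ε : ℝ) : Continuous (gradient (Geps ε : Vel d → ℝ)) := by
  have h := continuous_bracket (d := d)
  have h' := continuous_Geps (d := d) ε
  rw [funext (gradient_Geps (d := d) ε)]
  have : Continuous fun v : Vel d => (bracket (ε⁻¹ • v))⁻¹ :=
    (h.comp (by fun_prop)).inv₀ fun v => (one_pos.trans_le (one_le_bracket _)).ne'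
  fun_prop

theorem integrable_affine_mul_Geps {ε : ℝ} (hε : 0 < ε) (a b : ℝ) :
    Integrable fun v : Vel d => (a + b * ‖v‖) * Geps ε v := by
  have h1 := (integrable_norm_add_one_mul_exp_neg_bracket (d := d)).comp_smul
    (inv_ne_zero hε.ne')
  have h2 := (integrable_exp_neg_bracket (d := d)).comp_smul (inv_ne_zero hε.ne')
  set c := (ε ^ d)⁻¹ * (∫ w : Vel d, Real.exp (-bracket w))⁻¹ with hc
  refine ((h1.const_mul (c * b * ε)).add (h2.const_mul (c * (a - b * ε)))).congr
    (ae_of_all _ fun v => ?_)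
  simp only [Pi.add_apply, Geps, G, norm_smul, Real.norm_of_nonneg (inv_nonneg.2 hε.le), hc]
  field_simp
  ring

theorem integrable_gradient_Geps {ε : ℝ} (hε : 0 < ε) :
    Integrable (gradient (Geps ε : Vel d → ℝ)) := by
  refine ((integrable_affine_mul_Geps hε ε⁻¹ 0)).mono'
    (continuous_gradient_Geps ε).aestronglyMeasurable (ae_of_all _ fun v => ?_)
  simpa using norm_gradient_Geps_le hε v

theorem integrable_norm_mul_norm_gradient_Geps {ε : ℝ} (hε : 0 < ε) :
    Integrable fun v : Vel d => ‖v‖ * ‖gradient (Geps ε) v‖ := by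
  have := continuous_gradient_Geps (d := d) ε
  refine ((integrable_affine_mul_Geps hε 0 ε⁻¹)).mono'
    (by fun_prop) (ae_of_all _ fun v => ?_)
  rw [Real.norm_of_nonneg (by positivity)]
  nlinarith [mul_le_mul_of_nonneg_left (norm_gradient_Geps_le hε v) (norm_nonneg v)]

theorem integral_gradient_Geps (ε : ℝ) : ∫ v : Vel d, gradient (Geps ε) v = 0 := by
  have h := integral_neg_eq_self (gradient (Geps ε : Vel d → ℝ)) volume
  simp only [gradient_Geps_neg, integral_neg] at h
  have h2 : (2 : ℝ) • ∫ v : Vel d, gradient (Geps ε) v = 0 := by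
    rw [two_smul]; nth_rewrite 1 [← h]; exact neg_add_cancel _
  exact (smul_eq_zero.1 h2).resolve_left two_ne_zero

/-! ### The entropy gradient of an empirical measure. -/

theorem integral_empirical {E : Type*} [NormedAddCommGroup E] [NormedSpace ℝ E] [CompleteSpace E]
    {m : Fin N → ℝ} (hm : IsWeight m) (x : Fin N → Vel d) (f : Vel d → E) :
    ∫ w, f w ∂empirical m x = ∑ j, m j • f (x j) := by
  unfold empirical
  rw [integral_finsetSum_measure]
  · simp [integral_smul_measure, ENNReal.toReal_ofReal (hm.nonneg _)]
  · intro i _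
    exact (integrable_dirac (by simp)).smul_measure ENNReal.ofReal_ne_top

theorem mollify_empirical {m : Fin N → ℝ} (hm : IsWeight m) (ε : ℝ) (x : Fin N → Vel d)
    (v : Vel d) : mollify ε (empirical m x) v = ∑ j, m j * Geps ε (v - x j) :=
  integral_empirical hm x _

theorem mollify_empirical_pos {ε : ℝ} (hε : 0 < ε) {m : Fin N → ℝ} (hm : IsWeight m)
    (x : Fin N → Vel d) (v : Vel d) : 0 < mollify ε (empirical m x) v := by
  rw [mollify_empirical hm]
  obtain ⟨j, hj⟩ : ∃ j, m j ≠ 0 := by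
    by_contra! h
    simpa [h] using hm.sum_eq_one
  refine Finset.sum_pos' (fun j _ => mul_nonneg (hm.nonneg j) (Geps_pos hε _).le)
    ⟨j, Finset.mem_univ j, mul_pos ((hm.nonneg j).lt_of_ne' hj) (Geps_pos hε _)⟩

/-- The multiplicative bound `Geps_le` passes through the weighted sum. Only relative positions
enter, so moving the point and moving the particles are treated at once. -/
theorem log_mollify_le {ε : ℝ} (hε : 0 < ε) {m : Fin N → ℝ} (hm : IsWeight m)
    {x y : Fin N → Vel d} {v w : Vel d} {r : ℝ} (h : ∀ j, ‖(v - x j) - (w - y j)‖ ≤ r) :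
    Real.log (mollify ε (empirical m x) v) ≤
      ε⁻¹ * r + Real.log (mollify ε (empirical m y) w) := by
  have hw := mollify_empirical_pos hε hm y w
  rw [← Real.log_exp (ε⁻¹ * r), ← Real.log_mul (Real.exp_pos _).ne' hw.ne']
  refine Real.log_le_log (mollify_empirical_pos hε hm x v) ?_
  rw [mollify_empirical hm, mollify_empirical hm, Finset.mul_sum]
  refine Finset.sum_le_sum fun j _ => ?_
  have := hm.nonneg j
  have hG := Geps_pos hε (w - y j)
  calc m j * Geps ε (v - x j)
      ≤ m j * (Real.exp (ε⁻¹ * ‖(v - x j) - (w - y j)‖) * Geps ε (w - y j)) := by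
        gcongr; exact Geps_le hε _ _
    _ ≤ m j * (Real.exp (ε⁻¹ * r) * Geps ε (w - y j)) := by gcongr; exact h j
    _ = _ := by ring

theorem abs_log_mollify_sub_le {ε : ℝ} (hε : 0 < ε) {m : Fin N → ℝ} (hm : IsWeight m)
    {x y : Fin N → Vel d} {v w : Vel d} {r : ℝ} (h : ∀ j, ‖(v - x j) - (w - y j)‖ ≤ r) :
    |Real.log (mollify ε (empirical m x) v) - Real.log (mollify ε (empirical m y) w)| ≤
      ε⁻¹ * r := by
  have h1 := log_mollify_le hε hm h
  have h2 := log_mollify_le hε hm (x := y) (y := x) (v := w) (w := v) (r := r)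
    fun j => by rw [norm_sub_rev]; exact h j
  exact abs_sub_le_iff.2 ⟨by linarith, by linarith⟩

theorem continuous_log_mollify {ε : ℝ} (hε : 0 < ε) {m : Fin N → ℝ} (hm : IsWeight m)
    (x : Fin N → Vel d) : Continuous fun v => Real.log (mollify ε (empirical m x) v) := by
  refine Continuous.log ?_ fun v => (mollify_empirical_pos hε hm x v).ne'
  have := continuous_Geps (d := d) ε
  change Continuous (mollify ε (empirical m x))
  rw [funext (mollify_empirical hm ε x)]
  fun_prop

/-- Puts all dependence on `v` and `g` in the logarithm, which is Lipschitz, so that `∇G^ε` need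
only be integrated. -/
theorem entropyGrad_eq (ε : ℝ) (g : Measure (Vel d)) (v : Vel d) :
    entropyGrad ε g v = ∫ u, Real.log (mollify ε g (v - u)) • gradient (Geps ε) u := by
  unfold entropyGrad
  rw [← integral_sub_left_eq_self
    (fun w => Real.log (mollify ε g w) • gradient (Geps ε) (v - w)) volume v]
  simp

theorem integrable_log_mollify_smul_gradient {ε : ℝ} (hε : 0 < ε) {m : Fin N → ℝ}
    (hm : IsWeight m) (x : Fin N → Vel d) (v : Vel d) :
    Integrable fun u => Real.log (mollify ε (empirical m x) (v - u)) • gradient (Geps ε) u := by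
  have h1 := continuous_gradient_Geps (d := d) ε
  have h2 := continuous_log_mollify hε hm x
  refine (((integrable_gradient_Geps hε).norm.const_mul
    |Real.log (mollify ε (empirical m x) v)|).add
    ((integrable_norm_mul_norm_gradient_Geps hε).const_mul ε⁻¹)).mono'
    ((h2.comp (continuous_const.sub continuous_id)).smul h1).aestronglyMeasurable (ae_of_all _ fun u => ?_)
  have h3 := abs_log_mollify_sub_le hε hm (x := x) (y := x) (v := v - u) (w := v) (r := ‖u‖)
    fun j => by simp
  have h4 := abs_sub_abs_le_abs_sub (Real.log (mollify ε (empirical m x) (v - u)))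
    (Real.log (mollify ε (empirical m x) v))
  rw [norm_smul, Real.norm_eq_abs]
  simp only [Pi.add_apply]
  nlinarith [norm_nonneg (gradient (Geps ε) u)]

/-- A common Lipschitz constant of the fields `∇G^ε * log (μ * G^ε)`, jointly in the evaluation
point and in the positions of the particles. -/
noncomputable def entropyGradLip (d : ℕ) (ε : ℝ) : ℝ :=
  ε⁻¹ * ∫ u : Vel d, ‖gradient (Geps ε) u‖

/-- A common bound of the fields `∇G^ε * log (μ * G^ε)`. -/
noncomputable def entropyGradBound (d : ℕ) (ε : ℝ) : ℝ :=
  ε⁻¹ * ∫ u : Vel d, ‖u‖ * ‖gradient (Geps ε) u‖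

theorem entropyGradLip_nonneg {ε : ℝ} (hε : 0 < ε) : 0 ≤ entropyGradLip d ε :=
  mul_nonneg (by positivity) (integral_nonneg fun _ => norm_nonneg _)

theorem entropyGradBound_nonneg {ε : ℝ} (hε : 0 < ε) : 0 ≤ entropyGradBound d ε :=
  mul_nonneg (by positivity) (integral_nonneg fun _ => by positivity)

theorem norm_entropyGrad_sub_le {ε : ℝ} (hε : 0 < ε) {m : Fin N → ℝ} (hm : IsWeight m)
    {x y : Fin N → Vel d} {v w : Vel d} {r : ℝ} (h : ∀ j, ‖(v - x j) - (w - y j)‖ ≤ r) :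
    ‖entropyGrad ε (empirical m x) v - entropyGrad ε (empirical m y) w‖ ≤
      entropyGradLip d ε * r := by
  rw [entropyGrad_eq, entropyGrad_eq, ← integral_sub
    (integrable_log_mollify_smul_gradient hε hm x v)
    (integrable_log_mollify_smul_gradient hε hm y w)]
  refine (norm_integral_le_of_norm_le ((integrable_gradient_Geps hε).norm.const_mul (ε⁻¹ * r))
    (ae_of_all _ fun u => ?_)).trans_eq ?_
  · rw [← sub_smul, norm_smul]
    gcongr
    refine abs_log_mollify_sub_le hε hm fun j => ?_
    convert h j using 2
    abel
  · rw [integral_const_mul, entropyGradLip]; ring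

theorem norm_entropyGrad_le {ε : ℝ} (hε : 0 < ε) {m : Fin N → ℝ} (hm : IsWeight m)
    (x : Fin N → Vel d) (v : Vel d) :
    ‖entropyGrad ε (empirical m x) v‖ ≤ entropyGradBound d ε := by
  -- The logarithm itself has no uniform bound; as `∇G^ε` has mean zero, its value at `v` can be
  -- subtracted, leaving an increment of size at most `ε⁻¹ ‖u‖`.
  have h0 : ∫ u : Vel d, Real.log (mollify ε (empirical m x) v) • gradient (Geps ε) u = 0 := by
    rw [integral_smul, integral_gradient_Geps, smul_zero]
  rw [entropyGrad_eq, ← sub_zero (∫ u, _), ← h0, ← integral_sub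
    (integrable_log_mollify_smul_gradient hε hm x v)
    ((integrable_gradient_Geps hε).fun_smul (Real.log (mollify ε (empirical m x) v)))]
  refine (norm_integral_le_of_norm_le
    ((integrable_norm_mul_norm_gradient_Geps hε).const_mul ε⁻¹)
    (ae_of_all _ fun u => ?_)).trans_eq ?_
  · rw [← sub_smul, norm_smul, ← mul_assoc]
    gcongr
    exact abs_log_mollify_sub_le hε hm fun j => by simp
  · rw [integral_const_mul, entropyGradBound]

/-! ### Lipschitz estimates for the singular kernel. -/

theorem proj_apply (z w : Vel d) : proj z w = w - (inner ℝ z w / ‖z‖ ^ 2) • z := by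
  simp [proj, Submodule.starProjection_orthogonal, Submodule.starProjection_singleton]

theorem norm_proj_apply_le (z w : Vel d) : ‖proj z w‖ ≤ ‖w‖ := by
  simpa using (proj z).le_of_opNorm_le (Submodule.starProjection_norm_le _) w

theorem inner_proj_self (z w : Vel d) : inner ℝ z (proj z w) = 0 := by
  rcases eq_or_ne z 0 with rfl | hz
  · simp
  · have : ‖z‖ ≠ 0 := norm_ne_zero_iff.2 hz
    rw [proj_apply, inner_sub_right, inner_smul_right, real_inner_self_eq_norm_sq]
    field_simp
    ring

theorem proj_neg (z : Vel d) : proj (-z) = proj z := by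
  ext1 w
  rw [proj_apply, proj_apply, norm_neg, inner_neg_left]
  module

/-- The projection depends only on the direction of `z`. One factor 2 comes from the rank-one
difference in terms of unit vectors, the other from normalising. -/
theorem norm_mul_norm_proj_sub_le {z z' : Vel d} (hz : z ≠ 0) (hz' : z' ≠ 0) (w : Vel d) :
    ‖z‖ * ‖proj z w - proj z' w‖ ≤ 4 * ‖z - z'‖ * ‖w‖ := by
  have n1 : 0 < ‖z‖ := norm_pos_iff.2 hz
  have n2 : 0 < ‖z'‖ := norm_pos_iff.2 hz'
  obtain ⟨e, he⟩ : ∃ e, e = ‖z‖⁻¹ • z := ⟨_, rfl⟩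
  obtain ⟨e', he'⟩ : ∃ e', e' = ‖z'‖⁻¹ • z' := ⟨_, rfl⟩
  have e1 : ‖e‖ = 1 := by simp [he, norm_smul, n1.ne']
  have e2 : ‖e'‖ = 1 := by simp [he', norm_smul, n2.ne']
  have p (z : Vel d) : proj z w = w - inner ℝ (‖z‖⁻¹ • z) w • (‖z‖⁻¹ • z) := by
    rw [proj_apply, inner_smul_left, smul_smul]
    congr 2
    simp; ring
  have h1 : proj z w - proj z' w = -(inner ℝ (e - e') w • e + inner ℝ e' w • (e - e')) := by
    rw [p z, p z', ← he, ← he', inner_sub_left]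
    module
  have h2 : ‖proj z w - proj z' w‖ ≤ 2 * ‖e - e'‖ * ‖w‖ := by
    rw [h1, norm_neg]
    refine (norm_add_le _ _).trans ?_
    rw [norm_smul, norm_smul, e1]
    have a1 := norm_inner_le_norm (𝕜 := ℝ) (e - e') w
    have a2 := norm_inner_le_norm (𝕜 := ℝ) e' w
    rw [e2, one_mul] at a2
    nlinarith [mul_le_mul_of_nonneg_right a2 (norm_nonneg (e - e'))]
  have h3 : ‖z‖ * ‖e - e'‖ ≤ 2 * ‖z - z'‖ := by
    have : ‖z‖ • (e - e') = (z - z') + (‖z'‖ - ‖z‖) • e' := by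
      rw [smul_sub, sub_smul, he, he', smul_smul, smul_smul, smul_smul, mul_inv_cancel₀ n1.ne',
        mul_inv_cancel₀ n2.ne']
      module
    have h4 : ‖‖z‖ • (e - e')‖ ≤ ‖z - z'‖ + ‖z - z'‖ * 1 := by
      rw [this]
      refine (norm_add_le _ _).trans ?_
      rw [norm_smul, e2]
      gcongr
      rw [norm_sub_rev z z']
      exact abs_norm_sub_norm_le _ _
    rw [norm_smul, norm_norm] at h4
    linarith
  calc _ ≤ ‖z‖ * (2 * ‖e - e'‖ * ‖w‖) := by gcongr
    _ = 2 * (‖z‖ * ‖e - e'‖) * ‖w‖ := by ring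
    _ ≤ 2 * (2 * ‖z - z'‖) * ‖w‖ := by gcongr
    _ = _ := by ring

/-- Factoring out the larger power leaves `1 - t^|α| ≤ 1 - t^2` with `t = b / a ≤ 1`. -/
theorem abs_rpow_sub_rpow_mul_le {a b α M : ℝ} (hb : 0 < b) (hab : b ≤ a) (h1 : -2 ≤ α)
    (h2 : α ≤ 2) (ha : a ^ α ≤ M) (hb' : b ^ α ≤ M) :
    |a ^ α - b ^ α| * b ≤ 2 * M * (a - b) := by
  have ha0 : 0 < a := hb.trans_le hab
  have pa : 0 < a ^ α := Real.rpow_pos_of_pos ha0 α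
  have pb : 0 < b ^ α := Real.rpow_pos_of_pos hb α
  set t := b / a with ht
  have t0 : 0 < t := by positivity
  have t1 : t ≤ 1 := (div_le_one ha0).2 hab
  have hb_eq : b = t * a := by rw [ht]; field_simp
  have hta : b ^ α = t ^ α * a ^ α := by rw [hb_eq, Real.mul_rpow t0.le ha0.le]
  have key : ∀ s : ℝ, s ≤ 2 → t ^ 2 ≤ t ^ s := fun s hs => by
    rw [← Real.rpow_natCast t 2]
    exact Real.rpow_le_rpow_of_exponent_ge t0 t1 (by simpa using hs)
  have hsq : (1 - t ^ 2) * b ≤ 2 * (a - b) := by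
    have : (1 - t ^ 2) * b = (1 + t) * t * (a - b) := by rw [hb_eq]; ring
    rw [this]
    have : (1 + t) * t ≤ 2 := by nlinarith
    exact mul_le_mul_of_nonneg_right this (by linarith)
  rcases le_total 0 α with h | h
  · have h4 : b ^ α ≤ a ^ α := Real.rpow_le_rpow hb.le hab h
    rw [abs_of_nonneg (by linarith)]
    calc (a ^ α - b ^ α) * b = a ^ α * ((1 - t ^ α) * b) := by rw [hta]; ring
      _ ≤ a ^ α * ((1 - t ^ 2) * b) := by gcongr; exact key α h2
      _ ≤ M * (2 * (a - b)) :=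
        mul_le_mul ha hsq (mul_nonneg (by nlinarith) hb.le) (pa.le.trans ha)
      _ = _ := by ring
  · have h4 : a ^ α ≤ b ^ α := Real.rpow_le_rpow_of_nonpos hb hab h
    rw [abs_of_nonpos (by linarith)]
    have h5 : a ^ α = t ^ (-α) * b ^ α := by
      rw [hta, ← mul_assoc, ← Real.rpow_add t0]; simp
    calc -(a ^ α - b ^ α) * b = b ^ α * ((1 - t ^ (-α)) * b) := by rw [h5]; ring
      _ ≤ b ^ α * ((1 - t ^ 2) * b) := by gcongr; exact key (-α) (by linarith)
      _ ≤ M * (2 * (a - b)) :=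
        mul_le_mul hb' hsq (mul_nonneg (by nlinarith) hb.le) (pa.le.trans ha)
      _ = _ := by ring

/-- Varying the power or the projection costs a factor `1 / ‖z‖`, which the linear vanishing of `u`
absorbs. The 6 is 2 from the power plus 4 from the projection. -/
theorem norm_rpow_smul_proj_sub_le {α M L : ℝ} (h1 : -2 ≤ α) (h2 : α ≤ 2) (hM : 0 ≤ M)
    (hL : 0 ≤ L) {z z' u u' : Vel d} (hz : z ≠ 0 → ‖z‖ ^ α ≤ M) (hz' : z' ≠ 0 → ‖z'‖ ^ α ≤ M)
    (hu : ‖u‖ ≤ L * ‖z‖) (hu' : ‖u'‖ ≤ L * ‖z'‖) :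
    ‖‖z‖ ^ α • proj z u - ‖z'‖ ^ α • proj z' u'‖ ≤ M * ‖u - u'‖ + 6 * M * L * ‖z - z'‖ := by
  wlog h : ‖z'‖ ≤ ‖z‖ generalizing z z' u u'
  · rw [norm_sub_rev, norm_sub_rev u, norm_sub_rev z]
    exact this hz' hz hu' hu (le_of_not_ge h)
  rcases eq_or_ne z' 0 with rfl | h0'
  · have hu0 : u' = 0 := by simpa using hu'
    subst hu0
    rcases eq_or_ne z 0 with rfl | h0
    · have hu0 : u = 0 := by simpa using hu
      simp [hu0]
    · rw [map_zero, smul_zero, sub_zero, sub_zero, sub_zero, norm_smul,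
        Real.norm_of_nonneg (by positivity)]
      calc _ ≤ M * ‖u‖ := by gcongr; exacts [hz h0, norm_proj_apply_le _ _]
        _ ≤ _ := le_add_of_nonneg_right (by positivity)
  · have n' : 0 < ‖z'‖ := norm_pos_iff.2 h0'
    have n : 0 < ‖z‖ := n'.trans_le h
    have h0 : z ≠ 0 := norm_pos_iff.1 n
    have e : ‖z‖ ^ α • proj z u - ‖z'‖ ^ α • proj z' u' = ‖z‖ ^ α • proj z (u - u') +
        (‖z‖ ^ α - ‖z'‖ ^ α) • proj z u' + ‖z'‖ ^ α • (proj z u' - proj z' u') := by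
      rw [map_sub]; module
    have b1 : ‖‖z‖ ^ α • proj z (u - u')‖ ≤ M * ‖u - u'‖ := by
      rw [norm_smul, Real.norm_of_nonneg (by positivity)]
      gcongr
      exacts [hz h0, norm_proj_apply_le _ _]
    have b2 : ‖(‖z‖ ^ α - ‖z'‖ ^ α) • proj z u'‖ ≤ 2 * M * L * ‖z - z'‖ := by
      rw [norm_smul, Real.norm_eq_abs]
      calc _ ≤ |‖z‖ ^ α - ‖z'‖ ^ α| * (L * ‖z'‖) := by
            gcongr; exact (norm_proj_apply_le _ _).trans hu'
        _ = L * (|‖z‖ ^ α - ‖z'‖ ^ α| * ‖z'‖) := by ring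
        _ ≤ L * (2 * M * (‖z‖ - ‖z'‖)) := by
          exact mul_le_mul_of_nonneg_left
            (abs_rpow_sub_rpow_mul_le n' h h1 h2 (hz h0) (hz' h0')) hL
        _ ≤ L * (2 * M * ‖z - z'‖) := by gcongr; exact norm_sub_norm_le _ _
        _ = _ := by ring
    have b3 : ‖‖z'‖ ^ α • (proj z u' - proj z' u')‖ ≤ 4 * M * L * ‖z - z'‖ := by
      rw [norm_smul, Real.norm_of_nonneg (by positivity)]
      have := norm_mul_norm_proj_sub_le h0 h0' u'
      have h3 : ‖proj z u' - proj z' u'‖ ≤ 4 * ‖z - z'‖ * L := by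
        refine le_of_mul_le_mul_left ?_ n
        calc _ ≤ 4 * ‖z - z'‖ * ‖u'‖ := this
          _ ≤ 4 * ‖z - z'‖ * (L * ‖z‖) := by gcongr; exact hu'.trans (by gcongr)
          _ = _ := by ring
      calc _ ≤ M * (4 * ‖z - z'‖ * L) := by gcongr; exact hz' h0'
        _ = _ := by ring
    rw [e]
    refine (norm_add₃_le).trans ?_
    linarith

/-! ### The vector field: bound and Lipschitz estimate. -/

/-- The vector field of the particle system on the configuration space. -/
noncomputable def field (ε γ : ℝ) (m : Fin N → ℝ) (x : Fin N → Vel d) : Fin N → Vel d :=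
  fun i => velocity ε γ (empirical m x) (x i)

theorem field_apply {m : Fin N → ℝ} (hm : IsWeight m) (ε γ : ℝ) (x : Fin N → Vel d) (i : Fin N) :
    field ε γ m x i = ∑ j, m j • kernelK ε γ (empirical m x) (x i) (x j) :=
  integral_empirical hm x _

theorem kernelK_swap (ε γ : ℝ) (g : Measure (Vel d)) (v w : Vel d) :
    kernelK ε γ g w v = -kernelK ε γ g v w := by
  unfold kernelK
  rw [← neg_sub v w, proj_neg, norm_neg, ← neg_sub (entropyGrad ε g v), map_neg, smul_neg]

theorem inner_sub_kernelK (ε γ : ℝ) (g : Measure (Vel d)) (v w : Vel d) :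
    inner ℝ (v - w) (kernelK ε γ g v w) = 0 := by
  rw [kernelK, inner_neg_right, inner_smul_right, inner_proj_self, mul_zero, neg_zero]

/-- The factor `|x_i - x_j|^{2+γ}` is at most `M` for all particles at different positions. -/
def KernelBound (γ M : ℝ) (x : Fin N → Vel d) : Prop :=
  ∀ i j, x i ≠ x j → ‖x i - x j‖ ^ (2 + γ) ≤ M

theorem norm_entropyGrad_sub_entropyGrad_le {ε : ℝ} (hε : 0 < ε) {m : Fin N → ℝ}
    (hm : IsWeight m) (x : Fin N → Vel d) (v w : Vel d) :
    ‖entropyGrad ε (empirical m x) v - entropyGrad ε (empirical m x) w‖ ≤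
      2 * entropyGradBound d ε :=
  (norm_sub_le _ _).trans
    (by linarith [norm_entropyGrad_le hε hm x v, norm_entropyGrad_le hε hm x w])

theorem norm_kernelK_le {ε : ℝ} (hε : 0 < ε) (γ : ℝ) {m : Fin N → ℝ} (hm : IsWeight m)
    (x : Fin N → Vel d) (v w : Vel d) :
    ‖kernelK ε γ (empirical m x) v w‖ ≤ ‖v - w‖ ^ (2 + γ) * (2 * entropyGradBound d ε) := by
  rw [kernelK, norm_neg, norm_smul, Real.norm_of_nonneg (by positivity)]
  gcongr
  exact (norm_proj_apply_le _ _).trans (norm_entropyGrad_sub_entropyGrad_le hε hm x v w)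

theorem norm_sum_weight_smul_le {E : Type*} [NormedAddCommGroup E] [NormedSpace ℝ E]
    {m : Fin N → ℝ} (hm : IsWeight m) {f : Fin N → E} {C : ℝ} (h : ∀ j, ‖f j‖ ≤ C) :
    ‖∑ j, m j • f j‖ ≤ C := by
  calc _ ≤ ∑ j, m j * C := by
        refine norm_sum_le_of_le _ fun j _ => ?_
        rw [norm_smul, Real.norm_of_nonneg (hm.nonneg j)]
        exact mul_le_mul_of_nonneg_left (h j) (hm.nonneg j)
    _ = C := by rw [← Finset.sum_mul, hm.sum_eq_one, one_mul]

theorem norm_field_le {ε : ℝ} (hε : 0 < ε) {γ M : ℝ} (hM : 0 ≤ M) {m : Fin N → ℝ}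
    (hm : IsWeight m) {x : Fin N → Vel d} (hx : KernelBound γ M x) :
    ‖field ε γ m x‖ ≤ M * (2 * entropyGradBound d ε) := by
  have hB := entropyGradBound_nonneg (d := d) hε
  refine (pi_norm_le_iff_of_nonneg (by positivity)).2 fun i => ?_
  rw [field_apply hm]
  refine norm_sum_weight_smul_le hm fun j => ?_
  by_cases hij : x i = x j
  · simp only [kernelK, hij, sub_self, map_zero, smul_zero, neg_zero, norm_zero]
    positivity
  · exact (norm_kernelK_le hε γ hm x _ _).trans
      (mul_le_mul_of_nonneg_right (hx i j hij) (by positivity))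

theorem norm_field_sub_le {ε : ℝ} (hε : 0 < ε) {γ M : ℝ} (hγ : γ ∈ Set.Ioc (-3 : ℝ) 0)
    (hM : 0 ≤ M) {m : Fin N → ℝ} (hm : IsWeight m) {x y : Fin N → Vel d}
    (hx : KernelBound γ M x) (hy : KernelBound γ M y) :
    ‖field ε γ m x - field ε γ m y‖ ≤ 16 * M * entropyGradLip d ε * ‖x - y‖ := by
  have hL := entropyGradLip_nonneg (d := d) hε
  have hxy (i : Fin N) : ‖x i - y i‖ ≤ ‖x - y‖ := norm_le_pi_norm (x - y) i
  refine (pi_norm_le_iff_of_nonneg (by positivity)).2 fun i => ?_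
  rw [Pi.sub_apply, field_apply hm, field_apply hm, ← Finset.sum_sub_distrib]
  simp only [← smul_sub]
  refine norm_sum_weight_smul_le hm fun j => ?_
  have hd (x : Fin N → Vel d) : ‖entropyGrad ε (empirical m x) (x i) -
      entropyGrad ε (empirical m x) (x j)‖ ≤ entropyGradLip d ε * ‖x i - x j‖ :=
    norm_entropyGrad_sub_le hε hm fun k => by simp
  have hb (k : Fin N) : ‖entropyGrad ε (empirical m x) (x k) -
      entropyGrad ε (empirical m y) (y k)‖ ≤ entropyGradLip d ε * (2 * ‖x - y‖) := by
    refine norm_entropyGrad_sub_le hε hm fun l => ?_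
    rw [sub_sub_sub_comm]
    exact (norm_sub_le _ _).trans (by linarith [hxy k, hxy l])
  have h := norm_rpow_smul_proj_sub_le (α := 2 + γ) (by linarith [hγ.1]) (by linarith [hγ.2])
    hM hL (fun h => hx i j (sub_ne_zero.1 h)) (fun h => hy i j (sub_ne_zero.1 h)) (hd x) (hd y)
  have e1 : ‖(x i - x j) - (y i - y j)‖ ≤ 2 * ‖x - y‖ := by
    rw [sub_sub_sub_comm]
    exact (norm_sub_le _ _).trans (by linarith [hxy i, hxy j])
  have e2 : ‖(entropyGrad ε (empirical m x) (x i) - entropyGrad ε (empirical m x) (x j)) -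
      (entropyGrad ε (empirical m y) (y i) - entropyGrad ε (empirical m y) (y j))‖ ≤
      entropyGradLip d ε * (4 * ‖x - y‖) := by
    rw [sub_sub_sub_comm]
    exact (norm_sub_le _ _).trans (by linarith [hb i, hb j])
  rw [kernelK, kernelK, neg_sub_neg, norm_sub_rev]
  refine h.trans ?_
  -- Here `16 = 4 + 6 * 2`; total mass one keeps `N` and `m` out of the constant.
  calc _ ≤ M * (entropyGradLip d ε * (4 * ‖x - y‖)) +
        6 * M * entropyGradLip d ε * (2 * ‖x - y‖) := by gcongr
    _ = _ := by ring

/-! ### From Picard–Lindelöf to `C¹` solutions. -/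

/-- Picard–Lindelöf, keeping the fact that the solution stays in the ball: this is what secures
`KernelBound` along it. -/
theorem exists_forall_mem_Icc_hasDerivWithinAt_mem_closedBall {E : Type*} [NormedAddCommGroup E]
    [NormedSpace ℝ E] [CompleteSpace E] {F : E → E} {x₀ : E} {a K L T : ℝ} (hK : 0 ≤ K)
    (hL : 0 ≤ L) (hT : 0 ≤ T) (haT : L * T ≤ a)
    (hlip : ∀ x ∈ Metric.closedBall x₀ a, ∀ y ∈ Metric.closedBall x₀ a,
      ‖F x - F y‖ ≤ K * ‖x - y‖)
    (hbound : ∀ x ∈ Metric.closedBall x₀ a, ‖F x‖ ≤ L) :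
    ∃ u : ℝ → E, u 0 = x₀ ∧ (∀ t ∈ Set.Icc (0 : ℝ) T,
      HasDerivWithinAt u (F (u t)) (Set.Icc 0 T) t) ∧ ∀ t, u t ∈ Metric.closedBall x₀ a := by
  have ha : 0 ≤ a := (mul_nonneg hL hT).trans haT
  lift a to NNReal using ha
  lift K to NNReal using hK
  lift L to NNReal using hL
  let t₀ : Set.Icc (0 : ℝ) T := ⟨0, le_rfl, hT⟩
  have hf : IsPicardLindelof (fun _ => F) t₀ x₀ a 0 L K :=
    { lipschitzOnWith := fun _ _ => LipschitzOnWith.of_dist_le_mul fun x hx y hy => by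
        simpa [dist_eq_norm] using hlip x hx y hy
      continuousOn := fun _ _ => continuousOn_const
      norm_le := fun _ _ => hbound
      mul_max_le := by simpa [t₀, hT] using haT }
  have hx : x₀ ∈ Metric.closedBall x₀ ((0 : NNReal) : ℝ) := by simp
  obtain ⟨α, hα⟩ := ODE.FunSpace.exists_isFixedPt_next hf hx
  have hmem : ∀ t, α.compProj t ∈ Metric.closedBall x₀ (a : ℝ) := fun t =>
    α.compProj_mem_closedBall hf.mul_max_le
  refine ⟨α.compProj, ?_, fun t ht => ?_, hmem⟩
  · change α.compProj (t₀ : ℝ) = x₀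
    rw [ODE.FunSpace.compProj_val, ← hα, ODE.FunSpace.next_apply₀]
  · refine (ODE.hasDerivWithinAt_picard_Icc t₀.2 hf.continuousOn_uncurry
      α.continuous_compProj.continuousOn (fun t _ => hmem t) x₀ ht).congr_of_mem
      (fun t' ht' => ?_) ht
    nth_rw 1 [← hα]
    rw [ODE.FunSpace.compProj_of_mem ht', ODE.FunSpace.next_apply]

theorem continuousOn_field {ε : ℝ} (hε : 0 < ε) {γ M : ℝ} (hγ : γ ∈ Set.Ioc (-3 : ℝ) 0)
    (hM : 0 ≤ M) {m : Fin N → ℝ} (hm : IsWeight m) :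
    ContinuousOn (field ε γ m : (Fin N → Vel d) → _) {x | KernelBound γ M x} := by
  have hL := entropyGradLip_nonneg (d := d) hε
  refine (LipschitzOnWith.of_dist_le_mul
    (K := ⟨16 * M * entropyGradLip d ε, by positivity⟩) fun x hx y hy => ?_).continuousOn
  rw [dist_eq_norm, dist_eq_norm]
  exact norm_field_sub_le hε hγ hM hm hx hy

theorem isParticleSolution_of_hasDerivWithinAt {ε : ℝ} (hε : 0 < ε) {γ M T : ℝ}
    (hγ : γ ∈ Set.Ioc (-3 : ℝ) 0) (hM : 0 ≤ M) (hT : 0 < T) {m : Fin N → ℝ} (hm : IsWeight m)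
    {u : ℝ → Fin N → Vel d}
    (hu : ∀ t ∈ Set.Icc (0 : ℝ) T, HasDerivWithinAt u (field ε γ m (u t)) (Set.Icc 0 T) t)
    (hb : ∀ t ∈ Set.Icc (0 : ℝ) T, KernelBound γ M (u t)) :
    IsParticleSolution ε γ m (u 0) T fun i t => u t i := by
  have hode : ∀ i, ∀ t ∈ Set.Icc (0 : ℝ) T,
      HasDerivWithinAt (fun t => u t i) (field ε γ m (u t) i) (Set.Icc 0 T) t :=
    fun i t ht => hasDerivWithinAt_pi.1 (hu t ht) i
  refine ⟨fun i => ?_, hode, fun i => rfl⟩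
  have hU := uniqueDiffOn_Icc hT
  refine (contDiffOn_one_iff_derivWithin hU).2
    ⟨fun t ht => (hode i t ht).differentiableWithinAt, ?_⟩
  have hc : ContinuousOn (fun t => field ε γ m (u t)) (Set.Icc 0 T) :=
    (continuousOn_field hε hγ hM hm).comp (HasDerivWithinAt.continuousOn hu) hb
  exact ((continuous_apply i).comp_continuousOn hc).congr
    fun t ht => (hode i t ht).derivWithin (hU t ht)

theorem IsParticleSolution.hasDerivWithinAt {ε γ T : ℝ} {m : Fin N → ℝ} {v₀ : Fin N → Vel d}
    {v : Fin N → ℝ → Vel d} (h : IsParticleSolution ε γ m v₀ T v) {t : ℝ}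
    (ht : t ∈ Set.Icc (0 : ℝ) T) :
    HasDerivWithinAt (fun t i => v i t) (field ε γ m fun i => v i t) (Set.Icc 0 T) t :=
  hasDerivWithinAt_pi.2 fun i => h.ode i t ht

/-! ### Local existence with a time independent of the weights. -/

theorem exists_pos_le_norm_sub (x : Fin N → Vel d) :
    ∃ δ : ℝ, 0 < δ ∧ ∀ i j, x i ≠ x j → δ ≤ ‖x i - x j‖ := by
  have h : ∀ᶠ δ in nhdsWithin (0 : ℝ) (Set.Ioi 0), ∀ i j, x i ≠ x j → δ ≤ ‖x i - x j‖ := by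
    refine Filter.eventually_all.2 fun i => Filter.eventually_all.2 fun j => ?_
    by_cases hij : x i = x j
    · simp [hij]
    · filter_upwards [Ioc_mem_nhdsGT (norm_pos_iff.2 (sub_ne_zero.2 hij))] with δ hδ _ using hδ.2
  obtain ⟨δ, h1, h2⟩ := (h.and self_mem_nhdsWithin).exists
  exact ⟨δ, h2, h1⟩

/-- Initially coincident particles are moved together, so that the kernel is only evaluated at
pairs of points which stay apart for a short time. -/
theorem exists_time_forall_weight_exists_solution {ε γ : ℝ} (hε : 0 < ε)
    (hγ : γ ∈ Set.Ioc (-3 : ℝ) 0) (v₀ : Fin N → Vel d) :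
    ∃ T : ℝ, 0 < T ∧ ∀ m : Fin N → ℝ, IsWeight m →
      ∃ v : Fin N → ℝ → Vel d, IsParticleSolution ε γ m v₀ T v := by
  obtain ⟨δ, hδ, hsep⟩ := exists_pos_le_norm_sub v₀
  have hB := entropyGradBound_nonneg (d := d) hε
  have hΛ := entropyGradLip_nonneg (d := d) hε
  -- Within distance `δ / 4` of `v₀`, distances between clusters lie in `[δ / 2, D]`; `M` adds both
  -- endpoint powers to cover either sign of `2 + γ`.
  set D := 2 * (‖v₀‖ + δ / 4) with hD
  set M := (δ / 2) ^ (2 + γ) + D ^ (2 + γ) with hMdef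
  have hM : 0 ≤ M := by positivity
  -- A representative of each cluster, chosen from the initial position alone.
  let r : Fin N → Fin N := fun i => Set.rangeSplitting v₀ ⟨v₀ i, i, rfl⟩
  have hr : ∀ i, v₀ (r i) = v₀ i := fun i => Set.apply_rangeSplitting v₀ ⟨v₀ i, i, rfl⟩
  have hr_eq : ∀ i j, v₀ i = v₀ j → r i = r j := fun i j h => by simp only [r, h]
  have hKB : ∀ x ∈ Metric.closedBall v₀ (δ / 4), KernelBound γ M (x ∘ r) := by
    intro x hx i j hij
    have hne : v₀ (r i) ≠ v₀ (r j) := fun h => hij (by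
      simp only [Function.comp]; rw [hr_eq i j (by rw [← hr i, ← hr j, h])])
    rw [mem_closedBall_iff_norm] at hx
    have h1 := fun k => (norm_le_pi_norm (x - v₀) k).trans hx
    have h2 : ‖x‖ ≤ ‖v₀‖ + δ / 4 := by
      have := norm_add_le v₀ (x - v₀)
      rw [add_sub_cancel] at this
      linarith
    have hlow : δ / 2 ≤ ‖x (r i) - x (r j)‖ := by
      have e : v₀ (r i) - v₀ (r j) =
          (x (r i) - x (r j)) - (x - v₀) (r i) + (x - v₀) (r j) := by
        simp only [Pi.sub_apply]; abel
      have h3 := hsep _ _ hne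
      rw [e] at h3
      have h4 := norm_add_le ((x (r i) - x (r j)) - (x - v₀) (r i)) ((x - v₀) (r j))
      have h5 := norm_sub_le (x (r i) - x (r j)) ((x - v₀) (r i))
      linarith [h1 (r i), h1 (r j)]
    have hup : ‖x (r i) - x (r j)‖ ≤ D := by
      have h3 := norm_sub_le (x (r i)) (x (r j))
      linarith [norm_le_pi_norm x (r i), norm_le_pi_norm x (r j)]
    have hpos : 0 < δ / 2 := by positivity
    simp only [Function.comp]
    rcases le_total 0 (2 + γ) with h | h
    · exact (Real.rpow_le_rpow (norm_nonneg _) hup h).trans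
        (le_add_of_nonneg_left (by positivity))
    · exact (Real.rpow_le_rpow_of_nonpos hpos hlow h).trans
        (le_add_of_nonneg_right (by positivity))
  set L := M * (2 * entropyGradBound d ε) with hL
  have hL0 : 0 ≤ L := by positivity
  have hT : 0 < δ / 4 / (L + 1) := by positivity
  -- The time is fixed before `m`; `L + 1` guards against `L = 0`.
  refine ⟨δ / 4 / (L + 1), hT, fun m hm => ?_⟩
  obtain ⟨u, hu0, hu, hmem⟩ := exists_forall_mem_Icc_hasDerivWithinAt_mem_closedBall
    (F := fun x => field ε γ m (x ∘ r)) (x₀ := v₀) (a := δ / 4)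
    (K := 16 * M * entropyGradLip d ε) (by positivity) hL0 hT.le
    (by rw [mul_div_assoc', div_le_iff₀ (by positivity)]; nlinarith)
    (fun x hx y hy => (norm_field_sub_le hε hγ hM hm (hKB x hx) (hKB y hy)).trans (by
      gcongr
      exact (pi_norm_le_iff_of_nonneg (norm_nonneg _)).2 fun i => norm_le_pi_norm (x - y) (r i)))
    (fun x hx => norm_field_le hε hM hm (hKB x hx))
  refine ⟨fun i t => (u t ∘ r) i, ?_⟩
  have h0 : u 0 ∘ r = v₀ := by rw [hu0]; exact funext hr
  have key := isParticleSolution_of_hasDerivWithinAt (u := fun t => u t ∘ r) hε hγ hM hT hm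
    (fun t ht => hasDerivWithinAt_pi.2 fun i => ?_) fun t _ => hKB _ (hmem t)
  · rwa [h0] at key
  · have h1 := hasDerivWithinAt_pi.1 (hu t ht) (r i)
    -- Particles at the same point have the same velocity, so the representative's equation serves
    -- its whole cluster.
    have h2 : field ε γ m (u t ∘ r) (r i) = field ε γ m (u t ∘ r) i := by
      simp only [field, Function.comp, hr_eq _ _ (hr i)]
    rwa [h2] at h1

/-! ### Global existence and uniqueness for `γ ≥ -2`. -/

/-- Conservation of energy: the kernel is antisymmetric and orthogonal to `v - w`, so exchanging the
indices turns the double sum into its negative. -/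
theorem sum_weight_inner_field {m : Fin N → ℝ} (hm : IsWeight m) (ε γ : ℝ) (x : Fin N → Vel d) :
    ∑ i, m i * inner ℝ (x i) (field ε γ m x i) = 0 := by
  have h1 (i j : Fin N) : inner ℝ (x i) (kernelK ε γ (empirical m x) (x i) (x j)) =
      inner ℝ (x j) (kernelK ε γ (empirical m x) (x i) (x j)) := by
    rw [← sub_eq_zero, ← inner_sub_left, inner_sub_kernelK]
  have e : ∑ i, m i * inner ℝ (x i) (field ε γ m x i) =
      ∑ i, ∑ j, m i * m j * inner ℝ (x i) (kernelK ε γ (empirical m x) (x i) (x j)) := by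
    refine Finset.sum_congr rfl fun i _ => ?_
    rw [field_apply hm, inner_sum, Finset.mul_sum]
    exact Finset.sum_congr rfl fun j _ => by rw [inner_smul_right]; ring
  have e2 : ∑ i, ∑ j, m i * m j * inner ℝ (x i) (kernelK ε γ (empirical m x) (x i) (x j)) =
      -∑ i, ∑ j, m i * m j * inner ℝ (x i) (kernelK ε γ (empirical m x) (x i) (x j)) := by
    nth_rewrite 1 [Finset.sum_comm]
    simp only [← Finset.sum_neg_distrib]
    refine Finset.sum_congr rfl fun i _ => Finset.sum_congr rfl fun j _ => ?_
    rw [kernelK_swap, inner_neg_right, h1 i j]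
    ring
  rw [e]
  linarith

theorem rpow_le_one_add_sq {s α : ℝ} (hs : 0 ≤ s) (h1 : 0 ≤ α) (h2 : α ≤ 2) :
    s ^ α ≤ 1 + s ^ 2 := by
  rcases le_total s 1 with h | h
  · exact (Real.rpow_le_one hs h h1).trans (by nlinarith)
  · have := Real.rpow_le_rpow_of_exponent_le h h2
    rw [Real.rpow_two] at this
    linarith

theorem kernelBound_of_norm_le {γ ρ : ℝ} (hγ : γ ∈ Set.Icc (-2 : ℝ) 0) {x : Fin N → Vel d}
    (hx : ‖x‖ ≤ ρ) : KernelBound γ (1 + (2 * ρ) ^ 2) x := by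
  intro i j _
  have h : ‖x i - x j‖ ≤ 2 * ρ := (norm_sub_le _ _).trans
    (by linarith [norm_le_pi_norm x i, norm_le_pi_norm x j])
  exact (rpow_le_one_add_sq (norm_nonneg _) (by linarith [hγ.1]) (by linarith [hγ.2])).trans
    (by gcongr)

/-- Orthogonality replaces `x i` by the bounded `x j` in the inner product. This lowers the growth
in `‖x i‖` from cubic to quadratic, as a linear Grönwall argument for `‖x i‖ ^ 2` needs. -/
theorem abs_inner_field_le {ε γ A : ℝ} (hε : 0 < ε) (hγ : γ ∈ Set.Icc (-2 : ℝ) 0)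
    {m : Fin N → ℝ} (hm : IsWeight m) {x : Fin N → Vel d} (hA : 0 ≤ A)
    (hx : ∀ j, m j ≠ 0 → ‖x j‖ ≤ A) (i : Fin N) :
    |inner ℝ (x i) (field ε γ m x i)| ≤
      2 * A * entropyGradBound d ε * (1 + 2 * A ^ 2 + 2 * ‖x i‖ ^ 2) := by
  have hB := entropyGradBound_nonneg (d := d) hε
  rw [field_apply hm, inner_sum]
  set C := 2 * A * entropyGradBound d ε * (1 + 2 * A ^ 2 + 2 * ‖x i‖ ^ 2)
  calc _ ≤ ∑ j, m j * C := ?_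
    _ = C := by rw [← Finset.sum_mul, hm.sum_eq_one, one_mul]
  refine (Finset.abs_sum_le_sum_abs _ _).trans (Finset.sum_le_sum fun j _ => ?_)
  rw [inner_smul_right, abs_mul, abs_of_nonneg (hm.nonneg j)]
  rcases eq_or_ne (m j) 0 with h | h
  · simp [h]
  refine mul_le_mul_of_nonneg_left ?_ (hm.nonneg j)
  have e : inner ℝ (x i) (kernelK ε γ (empirical m x) (x i) (x j)) =
      inner ℝ (x j) (kernelK ε γ (empirical m x) (x i) (x j)) := by
    rw [← sub_eq_zero, ← inner_sub_left, inner_sub_kernelK]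
  have hz : ‖x i - x j‖ ^ (2 + γ) ≤ 1 + 2 * A ^ 2 + 2 * ‖x i‖ ^ 2 := by
    refine (rpow_le_one_add_sq (norm_nonneg _) (by linarith [hγ.1])
      (by linarith [hγ.2])).trans ?_
    have h1 : ‖x i - x j‖ ^ 2 ≤ (‖x i‖ + A) ^ 2 := by
      gcongr; exact (norm_sub_le _ _).trans (by linarith [hx j h])
    nlinarith [sq_nonneg (‖x i‖ - A)]
  rw [e]
  calc _ ≤ ‖x j‖ * ‖kernelK ε γ (empirical m x) (x i) (x j)‖ := abs_real_inner_le_norm _ _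
    _ ≤ A * ((1 + 2 * A ^ 2 + 2 * ‖x i‖ ^ 2) * (2 * entropyGradBound d ε)) := by
      refine mul_le_mul (hx j h) ?_ (norm_nonneg _) hA
      exact (norm_kernelK_le hε γ hm x _ _).trans (by gcongr)
    _ = C := by ring

/-- A bound for the particles that only depends on the initial data and on the time horizon.
The energy controls the particles of positive weight, and Grönwall's inequality the others. -/
theorem exists_norm_le_of_hasDerivWithinAt {ε γ T : ℝ} (hε : 0 < ε)
    (hγ : γ ∈ Set.Icc (-2 : ℝ) 0) {m : Fin N → ℝ} (hm : IsWeight m)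
    (v₀ : Fin N → Vel d) :
    ∃ R : ℝ, 0 ≤ R ∧ ∀ (u : ℝ → Fin N → Vel d) (χ : ℝ → ℝ), u 0 = v₀ →
      (∀ t, |χ t| ≤ 1) →
      (∀ t ∈ Set.Icc (0 : ℝ) T,
        HasDerivWithinAt u (χ t • field ε γ m (u t)) (Set.Icc 0 T) t) →
      ∀ t ∈ Set.Icc (0 : ℝ) T, ‖u t‖ ≤ R := by
  have hB := entropyGradBound_nonneg (d := d) hε
  set e₀ := ∑ i, m i * ‖v₀ i‖ ^ 2 with he₀
  -- From `m j * ‖u t j‖ ^ 2 ≤ e₀`; massless particles contribute `e₀ / 0 = 0`.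
  set A := ∑ i, Real.sqrt (e₀ / m i) with hA
  have hA0 : 0 ≤ A := Finset.sum_nonneg fun _ _ => Real.sqrt_nonneg _
  set K := 8 * A * entropyGradBound d ε with hK
  set b := 4 * A * entropyGradBound d ε * (1 + 2 * A ^ 2) with hb
  have hK0 : 0 ≤ K := by positivity
  have hb0 : 0 ≤ b := by positivity
  refine ⟨Real.sqrt (gronwallBound (‖v₀‖ ^ 2) K b T), Real.sqrt_nonneg _,
    fun u χ hu0 hχ hu => ?_⟩
  have hcont := HasDerivWithinAt.continuousOn hu
  have hsq (i : Fin N) (t : ℝ) (ht : t ∈ Set.Icc 0 T) :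
      HasDerivWithinAt (fun t => ‖u t i‖ ^ 2)
        (2 * (χ t * inner ℝ (u t i) (field ε γ m (u t) i))) (Set.Icc 0 T) t := by
    have := (hasDerivWithinAt_pi.1 (hu t ht) i).norm_sq
    rwa [Pi.smul_apply, inner_smul_right] at this
  have hsq' (i : Fin N) (t : ℝ) (ht : t ∈ Set.Ico 0 T) :=
    (hsq i t (Set.Ico_subset_Icc_self ht)).mono_of_mem_nhdsWithin (Icc_mem_nhdsGE_of_mem ht)
  have hsqc (i : Fin N) := HasDerivWithinAt.continuousOn (hsq i)
  -- The scalar `χ t` factors out of the energy derivative, so truncation does not spoil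
  -- conservation.
  have henergy : ∀ t ∈ Set.Icc (0 : ℝ) T, ∑ i, m i * ‖u t i‖ ^ 2 = e₀ := by
    have h := constant_of_has_deriv_right_zero (f := fun t => ∑ i, m i * ‖u t i‖ ^ 2)
      (a := 0) (b := T) (continuousOn_finsetSum _ fun i _ => (hsqc i).const_mul (m i))
      fun t ht => by
        refine (HasDerivWithinAt.fun_sum fun i _ =>
          (hsq' i t ht).const_mul (m i)).congr_deriv ?_
        have := sum_weight_inner_field hm ε γ (u t)
        calc _ = 2 * χ t * ∑ i, m i * inner ℝ (u t i) (field ε γ m (u t) i) := by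
              rw [Finset.mul_sum]; exact Finset.sum_congr rfl fun i _ => by ring
          _ = 0 := by rw [this, mul_zero]
    intro t ht
    rw [h t ht, hu0]
  have hpos : ∀ t ∈ Set.Icc (0 : ℝ) T, ∀ j, m j ≠ 0 → ‖u t j‖ ≤ A := by
    intro t ht j hj
    have hj' : 0 < m j := (hm.nonneg j).lt_of_ne' hj
    have h1 : m j * ‖u t j‖ ^ 2 ≤ e₀ := by
      rw [← henergy t ht]
      exact Finset.single_le_sum (f := fun i => m i * ‖u t i‖ ^ 2)
        (fun i _ => mul_nonneg (hm.nonneg i) (sq_nonneg _)) (Finset.mem_univ j)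
    refine (Real.le_sqrt_of_sq_le ((le_div_iff₀' hj').2 h1)).trans ?_
    exact Finset.single_le_sum (f := fun i => Real.sqrt (e₀ / m i))
      (fun i _ => Real.sqrt_nonneg _) (Finset.mem_univ j)
  intro t ht
  refine (pi_norm_le_iff_of_nonneg (Real.sqrt_nonneg _)).2 fun i => Real.le_sqrt_of_sq_le ?_
  have h := norm_le_gronwallBound_of_norm_deriv_right_le (δ := ‖v₀‖ ^ 2) (K := K) (ε := b)
    (hsqc i) (hsq' i) (by
      rw [hu0, Real.norm_of_nonneg (by positivity)]
      gcongr
      exact norm_le_pi_norm v₀ i) (fun s hs => by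
      rw [Real.norm_eq_abs, Real.norm_of_nonneg (by positivity), abs_mul, abs_mul, abs_two]
      have h1 := abs_inner_field_le hε hγ hm hA0 (hpos s (Set.Ico_subset_Icc_self hs)) i
      have h2 := mul_le_mul (hχ s) h1 (abs_nonneg _) zero_le_one
      rw [hK, hb]
      linarith) t ht
  rw [Real.norm_of_nonneg (by positivity), sub_zero] at h
  exact h.trans (gronwallBound_mono (by positivity) hb0 hK0 ht.2)

theorem exists_unique_solution {ε γ T : ℝ} (hε : 0 < ε) (hγ : γ ∈ Set.Icc (-2 : ℝ) 0)
    {m : Fin N → ℝ} (hm : IsWeight m) (v₀ : Fin N → Vel d) (hT : 0 < T) :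
    ∃ v : Fin N → ℝ → Vel d, IsParticleSolution ε γ m v₀ T v ∧
      ∀ w : Fin N → ℝ → Vel d, IsParticleSolution ε γ m v₀ T w →
        ∀ i, ∀ t ∈ Set.Icc (0 : ℝ) T, w i t = v i t := by
  have hγ' : γ ∈ Set.Ioc (-3 : ℝ) 0 := ⟨by linarith [hγ.1], hγ.2⟩
  have hB := entropyGradBound_nonneg (d := d) hε
  have hΛ := entropyGradLip_nonneg (d := d) hε
  obtain ⟨R, hR0, hR⟩ := exists_norm_le_of_hasDerivWithinAt (T := T) hε hγ hm v₀
  -- The cutoff makes the field bounded everywhere by `L` below, so a ball of radius `L * T` holds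
  -- the solution up to time `T`.
  let χ : (Fin N → Vel d) → ℝ := fun x => max 0 (min 1 (R + 1 - ‖x‖))
  have hχ0 (x) : 0 ≤ χ x := le_max_left _ _
  have hχ1 (x) : χ x ≤ 1 := max_le zero_le_one (min_le_left _ _)
  have hχR (x) (hx : ‖x‖ ≤ R) : χ x = 1 := by
    simp only [χ]
    rw [min_eq_left (by linarith), max_eq_right zero_le_one]
  have hχout (x) (hx : R + 1 < ‖x‖) : χ x = 0 :=
    max_eq_left ((min_le_right _ _).trans (by linarith))
  have hχlip (x y) : |χ x - χ y| ≤ ‖x - y‖ := by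
    calc |χ x - χ y| ≤ |min 1 (R + 1 - ‖x‖) - min 1 (R + 1 - ‖y‖)| := by
          have := abs_max_sub_max_le_max (0 : ℝ) (min 1 (R + 1 - ‖x‖)) 0 (min 1 (R + 1 - ‖y‖))
          simpa using this
      _ ≤ |(R + 1 - ‖x‖) - (R + 1 - ‖y‖)| := by
          have := abs_min_sub_min_le_max (1 : ℝ) (R + 1 - ‖x‖) 1 (R + 1 - ‖y‖)
          simpa using this
      _ = |‖y‖ - ‖x‖| := by congr 1; ring
      _ ≤ ‖x - y‖ := by rw [norm_sub_rev]; exact abs_norm_sub_norm_le _ _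
  set L := (1 + (2 * (R + 1)) ^ 2) * (2 * entropyGradBound d ε) with hL
  have hL0 : 0 ≤ L := by positivity
  set M := 1 + (2 * (‖v₀‖ + L * T)) ^ 2 with hMdef
  have hM : 0 ≤ M := by positivity
  have hball (x) (hx : x ∈ Metric.closedBall v₀ (L * T)) : KernelBound γ M x := by
    refine kernelBound_of_norm_le hγ ?_
    rw [mem_closedBall_iff_norm] at hx
    have := norm_add_le v₀ (x - v₀)
    rw [add_sub_cancel] at this
    linarith
  obtain ⟨u, hu0, hu, hmem⟩ := exists_forall_mem_Icc_hasDerivWithinAt_mem_closedBall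
    (F := fun x => χ x • field ε γ m x) (x₀ := v₀) (a := L * T) (L := L) (T := T)
    (K := 16 * M * entropyGradLip d ε + M * (2 * entropyGradBound d ε)) (by positivity) hL0 hT.le
    le_rfl
    (fun x hx y hy => by
      have e : χ x • field ε γ m x - χ y • field ε γ m y =
          χ x • (field ε γ m x - field ε γ m y) + (χ x - χ y) • field ε γ m y := by module
      have h1 := norm_field_sub_le hε hγ' hM hm (hball x hx) (hball y hy)
      have h2 := norm_field_le hε hM hm (hball y hy)
      rw [e]
      refine (norm_add_le _ _).trans ?_
      rw [norm_smul, norm_smul, Real.norm_of_nonneg (hχ0 x), Real.norm_eq_abs]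
      have h3 := mul_le_mul (hχ1 x) h1 (norm_nonneg _) zero_le_one
      have h4 := mul_le_mul (hχlip x y) h2 (norm_nonneg _) (norm_nonneg _)
      linarith)
    (fun x _ => by
      rcases le_or_gt ‖x‖ (R + 1) with h | h
      · rw [norm_smul, Real.norm_of_nonneg (hχ0 x)]
        have h1 := norm_field_le hε (by positivity) hm (kernelBound_of_norm_le hγ h)
        have h2 := mul_le_mul (hχ1 x) h1 (norm_nonneg _) zero_le_one
        linarith
      · simpa [hχout x h] using hL0)
  -- The a priori bound also covers the truncated equation and confines `u` to the region where the
  -- cutoff equals 1.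
  have huR := hR u (fun t => χ (u t)) hu0
    (fun t => by rw [abs_of_nonneg (hχ0 _)]; exact hχ1 _) hu
  have hu' : ∀ t ∈ Set.Icc (0 : ℝ) T,
      HasDerivWithinAt u (field ε γ m (u t)) (Set.Icc 0 T) t := fun t ht => by
    simpa [hχR _ (huR t ht)] using hu t ht
  have hsol := isParticleSolution_of_hasDerivWithinAt hε hγ' hM hT hm hu' fun t _ => hball _ (hmem t)
  rw [hu0] at hsol
  refine ⟨_, hsol, fun w hw i t ht => ?_⟩
  have hw' := fun t (ht : t ∈ Set.Icc 0 T) => hw.hasDerivWithinAt ht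
  have hw0 : (fun i => w i 0) = v₀ := funext hw.init
  -- With factor 1 the same bound holds for any competitor, so both solutions live where the field
  -- is Lipschitz.
  have hwR := hR (fun t i => w i t) (fun _ => 1) hw0 (by simp)
    (by simpa only [one_smul] using hw')
  have hlip : LipschitzOnWith ⟨16 * (1 + (2 * R) ^ 2) * entropyGradLip d ε, by positivity⟩
      (field ε γ m : (Fin N → Vel d) → _) {x | ‖x‖ ≤ R} :=
    LipschitzOnWith.of_dist_le_mul fun x hx y hy => by
      rw [dist_eq_norm, dist_eq_norm]
      exact norm_field_sub_le hε hγ' (by positivity) hm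
        (kernelBound_of_norm_le hγ hx) (kernelBound_of_norm_le hγ hy)
  have hIci {f : ℝ → Fin N → Vel d}
      (hf : ∀ t ∈ Set.Icc (0 : ℝ) T, HasDerivWithinAt f (field ε γ m (f t)) (Set.Icc 0 T) t)
      (t : ℝ) (ht : t ∈ Set.Ico 0 T) :=
    (hf t (Set.Ico_subset_Icc_self ht)).mono_of_mem_nhdsWithin (Icc_mem_nhdsGE_of_mem ht)
  have heq := ODE_solution_unique_of_mem_Icc_right (v := fun _ => field ε γ m)
    (s := fun _ => {x | ‖x‖ ≤ R}) (fun _ _ => hlip)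
    (HasDerivWithinAt.continuousOn hw') (hIci hw')
    (fun t ht => hwR t (Set.Ico_subset_Icc_self ht))
    (HasDerivWithinAt.continuousOn hu') (hIci hu')
    (fun t ht => huR t (Set.Ico_subset_Icc_self ht)) (by rw [hw0, hu0])
  exact congrFun (heq ht) i

end RegLandau

theorem lemma2 (d : ℕ) (hd : 2 ≤ d) (ε : ℝ) (hε : 0 < ε) (γ : ℝ) (hγ : γ ∈ Set.Ioc (-3 : ℝ) 0)
    (N : ℕ) (v₀ : Fin N → RegLandau.Vel d) :
    (∃ T : ℝ, 0 < T ∧ ∀ m : Fin N → ℝ, RegLandau.IsWeight m →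
      ∃ v : Fin N → ℝ → RegLandau.Vel d, RegLandau.IsParticleSolution ε γ m v₀ T v) ∧
    (γ ∈ Set.Icc (-2 : ℝ) 0 →
      ∀ m : Fin N → ℝ, RegLandau.IsWeight m → ∀ T : ℝ, 0 < T →
        ∃ v : Fin N → ℝ → RegLandau.Vel d, RegLandau.IsParticleSolution ε γ m v₀ T v ∧
          ∀ w : Fin N → ℝ → RegLandau.Vel d, RegLandau.IsParticleSolution ε γ m v₀ T w →
            ∀ i, ∀ t ∈ Set.Icc (0 : ℝ) T, w i t = v i t) :=
  ⟨RegLandau.exists_time_forall_weight_exists_solution hε hγ v₀,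
    fun hγ' _ hm _ hT => RegLandau.exists_unique_solution hε hγ' hm v₀ hT⟩
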